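/- Conventions. For an open set $\Omega\subset\mathbb{R}^n$ let $\mathcal{D}(\Omega)$ be the space of complex-valued test functions with its usual LF topology and $\mathcal{D}'(\Omega)$ the space of complex distributions (continuous $\mathbb{C}$-linear forms on $\mathcal{D}(\Omega)$). For $u\in\mathcal{D}'(\Omega)$, $\chi\in\mathcal{D}(\Omega)$, $k\in\mathbb{R}^n$ put $\widehat{u\chi}(k)=\langle u,\chi e^{-i x\cdot k}\rangle$. A cone is a set stable under multiplication (of the covector) by every $\lambda>0$. Let $\dot T^*\Omega=\{(x;\xi):x\in\Omega,\ \xi\in\mathbb{R}^n\setminus\{0\}\}$. The wave front set $\mathrm{WF}(u)\subset\dot T^*\Omega$ is the complement of the set of $(x;\xi)\in\dot T^*\Omega$ for which there are an open neighbourhood $U$ of $x$ and an open cone $V\ni\xi$ such that $\sup_{k\in V}(1+|k|)^N|\widehat{u\varphi}(k)|<\infty$ for every $N\in\mathbb{N}$ and every $\varphi\in\mathcal{D}(\Omega)$ with $\mathrm{supp}\,\varphi\subset U$. For a cone $\Gamma\subset\dot T^*\Omega$ that is closed in $\dot T^*\Omega$, let $\mathcal{D}'_\Gamma(\Omega)=\{u\in\mathcal{D}'(\Omega):\mathrm{WF}(u)\subset\Gamma\}$.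 A sequence $(u_j)$ in $\mathcal{D}'_\Gamma(\Omega)$ converges to $u\in\mathcal{D}'_\Gamma(\Omega)$ in the sense of Hörmander if $\langle u_j,\varphi\rangle\to\langle u,\varphi\rangle$ for every $\varphi\in\mathcal{D}(\Omega)$ and, for every $\chi\in\mathcal{D}(\Omega)$, every $N\in\mathbb{N}$ and every closed cone $V\subset\mathbb{R}^n$ with $(\mathrm{supp}\,\chi\times V)\cap\Gamma=\emptyset$, $$\sup_{k\in V}(1+|k|)^N\,|\widehat{u_j\chi}(k)-\widehat{u\chi}(k)|\to 0\quad(j\to\infty).$$ The bounded subsets of $\mathcal{D}'_\Gamma(\Omega)$ are those of the von Neumann bornology of the locally convex (Hörmander) topology defined by the seminorms $|\langle u,\varphi\rangle|$ for $\varphi\in\mathcal{D}(\Omega)$ and $\|u\|_{N,V,\chi}=\sup_{k\in V}(1+|k|)^N|\widehat{u\chi}(k)|$ for $N,V,\chi$ as above; that is, the sets absorbed by every neighbourhood of $0$. Proposition. Let $\Omega_1\subset\mathbb{R}^{n_1}$ and $\Omega_2\subset\mathbb{R}^{n_2}$ be open, let $\Gamma_1\subset\dot T^*\Omega_1$ and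 $\Gamma_2\subset\dot T^*\Omega_2$ be closed cones, and let $f:\mathcal{D}'_{\Gamma_1}(\Omega_1)\to\mathcal{D}'_{\Gamma_2}(\Omega_2)$ be a $\mathbb{C}$-linear map. Then $f$ is sequentially continuous (whenever $u_j\to u$ in the sense of Hörmander in $\mathcal{D}'_{\Gamma_1}(\Omega_1)$, $f(u_j)\to f(u)$ in the sense of Hörmander in $\mathcal{D}'_{\Gamma_2}(\Omega_2)$) if and only if $f$ is bounded (the image of every bounded subset of $\mathcal{D}'_{\Gamma_1}(\Omega_1)$ is a bounded subset of $\mathcal{D}'_{\Gamma_2}(\Omega_2)$). -/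

import Mathlib

open Filter Topology TopologicalSpace
open scoped Distributions ContDiff

noncomputable section

namespace Microlocal

variable {n : ℕ}

/-- The space `ℝⁿ` with its Euclidean norm and inner product. -/
abbrev Rn (n : ℕ) : Type := EuclideanSpace ℝ (Fin n)

/-- Complex distributions on the open set `Ω ⊆ ℝⁿ`: continuous `ℂ`-linear forms on the space
`𝓓(Ω, ℂ)` of complex test functions with its canonical LF topology. -/
abbrev Distr (Ω : Opens (Rn n)) : Type := 𝓓(Ω, ℂ) →L[ℂ] ℂ

/-- The plane wave `x ↦ exp (-i x·k)`. -/
def planeWave (k x : Rn n) : ℂ := Complex.exp (-(Complex.I * ((inner ℝ x k : ℝ) : ℂ)))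

theorem contDiff_planeWave (k : Rn n) : ContDiff ℝ ∞ (planeWave k) := by
  unfold planeWave
  refine ContDiff.cexp (ContDiff.neg (contDiff_const.mul ?_))
  exact Complex.ofRealCLM.contDiff.comp (contDiff_id.inner ℝ contDiff_const)

/-- The product `g χ` of a test function `χ` and a smooth function `g`, as a test function. -/
def smoothMul {Ω : Opens (Rn n)} (g : Rn n → ℂ) (hg : ContDiff ℝ ∞ g) (χ : 𝓓(Ω, ℂ)) :
    𝓓(Ω, ℂ) where
  toFun x := g x * χ x
  contDiff' := hg.mul χ.contDiff
  hasCompactSupport' := χ.hasCompactSupport.mul_left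
  tsupport_subset' := (tsupport_mul_subset_right (f := g)).trans χ.tsupport_subset

/-- The Fourier transform of the compactly supported distribution `u χ`:
`(u χ)^(k) = ⟨u χ, exp (-i x·k)⟩ = ⟨u, χ exp (-i x·k)⟩`. -/
def fourierLoc {Ω : Opens (Rn n)} (χ : 𝓓(Ω, ℂ)) (k : Rn n) (u : Distr Ω) : ℂ :=
  u (smoothMul (planeWave k) (contDiff_planeWave k) χ)

/-- A subset of `ℝⁿ` is a cone if it is stable under multiplication by positive reals. -/
def IsCone (V : Set (Rn n)) : Prop :=
  ∀ ⦃ξ : Rn n⦄, ξ ∈ V → ∀ ⦃t : ℝ⦄, 0 < t → t • ξ ∈ V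

/-- The cotangent bundle of `Ω` without its zero section. -/
def punctured (Ω : Opens (Rn n)) : Set (Rn n × Rn n) :=
  {p | p.1 ∈ Ω ∧ p.2 ≠ 0}

/-- `Γ` is a closed cone of the punctured cotangent bundle of `Ω`: it is contained in that bundle,
relatively closed in it, and stable under multiplication of covectors by positive reals. -/
structure IsClosedCone (Ω : Opens (Rn n)) (Γ : Set (Rn n × Rn n)) : Prop where
  subset : Γ ⊆ punctured Ω
  isClosed : ∃ F : Set (Rn n × Rn n), IsClosed F ∧ Γ = F ∩ punctured Ω
  smul_mem : ∀ ⦃x ξ : Rn n⦄, (x, ξ) ∈ Γ → ∀ ⦃t : ℝ⦄, 0 < t → (x, t • ξ) ∈ Γ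

/-- `u` is microlocally smooth at `(x, ξ)`: there are an open neighbourhood `U` of `x` and an open
cone `V` containing `ξ` such that, for every test function `φ` supported in `U`, the Fourier
transform of `u φ` decreases rapidly on `V`. -/
def MicroSmoothAt {Ω : Opens (Rn n)} (u : Distr Ω) (x ξ : Rn n) : Prop :=
  ∃ U : Set (Rn n), IsOpen U ∧ x ∈ U ∧ ∃ V : Set (Rn n), IsOpen V ∧ IsCone V ∧ ξ ∈ V ∧
    ∀ φ : 𝓓(Ω, ℂ), tsupport φ ⊆ U → ∀ N : ℕ, ∃ C : ℝ, ∀ k ∈ V,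
      (1 + ‖k‖) ^ N * ‖fourierLoc φ k u‖ ≤ C

/-- The wave front set of a distribution. -/
def waveFrontSet {Ω : Opens (Rn n)} (u : Distr Ω) : Set (Rn n × Rn n) :=
  {p | p ∈ punctured Ω ∧ ¬ MicroSmoothAt u p.1 p.2}

section Algebra

variable {Ω : Opens (Rn n)} (χ : 𝓓(Ω, ℂ)) (k : Rn n)

theorem fourierLoc_zero : fourierLoc χ k (0 : Distr Ω) = 0 := rfl

theorem fourierLoc_add (u v : Distr Ω) :
    fourierLoc χ k (u + v) = fourierLoc χ k u + fourierLoc χ k v := rfl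

theorem fourierLoc_smul (c : ℂ) (u : Distr Ω) :
    fourierLoc χ k (c • u) = c * fourierLoc χ k u := rfl

theorem MicroSmoothAt.zero (x ξ : Rn n) : MicroSmoothAt (0 : Distr Ω) x ξ :=
  ⟨Set.univ, isOpen_univ, trivial, Set.univ, isOpen_univ, fun _ _ _ _ => trivial, trivial,
    fun φ _ N => ⟨0, fun k _ => by simp [fourierLoc_zero]⟩⟩

theorem MicroSmoothAt.add {u v : Distr Ω} {x ξ : Rn n} (hu : MicroSmoothAt u x ξ)
    (hv : MicroSmoothAt v x ξ) : MicroSmoothAt (u + v) x ξ := by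
  obtain ⟨U, hU, hxU, V, hV, hVc, hξV, h⟩ := hu
  obtain ⟨U', hU', hxU', V', hV', hVc', hξV', h'⟩ := hv
  refine ⟨U ∩ U', hU.inter hU', ⟨hxU, hxU'⟩, V ∩ V', hV.inter hV',
    fun η hη t ht => ⟨hVc hη.1 ht, hVc' hη.2 ht⟩, ⟨hξV, hξV'⟩, fun φ hφ N => ?_⟩
  obtain ⟨C, hC⟩ := h φ (hφ.trans Set.inter_subset_left) N
  obtain ⟨C', hC'⟩ := h' φ (hφ.trans Set.inter_subset_right) N
  refine ⟨C + C', fun k hk => ?_⟩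
  rw [fourierLoc_add]
  calc (1 + ‖k‖) ^ N * ‖fourierLoc φ k u + fourierLoc φ k v‖
      ≤ (1 + ‖k‖) ^ N * (‖fourierLoc φ k u‖ + ‖fourierLoc φ k v‖) := by
        gcongr; exact norm_add_le _ _
    _ ≤ C + C' := by rw [mul_add]; exact add_le_add (hC k hk.1) (hC' k hk.2)

theorem MicroSmoothAt.smul {u : Distr Ω} {x ξ : Rn n} (c : ℂ) (hu : MicroSmoothAt u x ξ) :
    MicroSmoothAt (c • u) x ξ := by
  obtain ⟨U, hU, hxU, V, hV, hVc, hξV, h⟩ := hu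
  refine ⟨U, hU, hxU, V, hV, hVc, hξV, fun φ hφ N => ?_⟩
  obtain ⟨C, hC⟩ := h φ hφ N
  refine ⟨‖c‖ * C, fun k hk => ?_⟩
  rw [fourierLoc_smul, norm_mul, mul_left_comm]
  exact mul_le_mul_of_nonneg_left (hC k hk) (norm_nonneg c)

end Algebra

/-- The space of distributions on `Ω` whose wave front set is contained in `Γ`, as a linear
subspace of the space of all distributions on `Ω`. -/
def dGammaSubmodule (Ω : Opens (Rn n)) (Γ : Set (Rn n × Rn n)) : Submodule ℂ (Distr Ω) where
  carrier := {u | waveFrontSet u ⊆ Γ}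
  zero_mem' := fun p hp => (hp.2 (MicroSmoothAt.zero p.1 p.2)).elim
  add_mem' := fun {u v} hu hv p hp => by
    by_contra hpΓ
    have hu' : MicroSmoothAt u p.1 p.2 := by
      by_contra h
      exact hpΓ (hu ⟨hp.1, h⟩)
    have hv' : MicroSmoothAt v p.1 p.2 := by
      by_contra h
      exact hpΓ (hv ⟨hp.1, h⟩)
    exact hp.2 (hu'.add hv')
  smul_mem' := fun c u hu p hp => by
    by_contra hpΓ
    have hu' : MicroSmoothAt u p.1 p.2 := by
      by_contra h
      exact hpΓ (hu ⟨hp.1, h⟩)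
    exact hp.2 (hu'.smul c)

/-- The vector space `𝓓'_Γ(Ω)`. It is a type of its own, so that it does not inherit the
topology of the space of all distributions. -/
def DGamma (Ω : Opens (Rn n)) (Γ : Set (Rn n × Rn n)) : Type := ↥(dGammaSubmodule Ω Γ)

namespace DGamma

variable {Ω : Opens (Rn n)} {Γ : Set (Rn n × Rn n)}

instance : AddCommGroup (DGamma Ω Γ) := inferInstanceAs (AddCommGroup ↥(dGammaSubmodule Ω Γ))

instance : Module ℂ (DGamma Ω Γ) := inferInstanceAs (Module ℂ ↥(dGammaSubmodule Ω Γ))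

variable (Ω Γ) in
/-- The inclusion of `𝓓'_Γ(Ω)` in the space of distributions. -/
def toDistr : DGamma Ω Γ →ₗ[ℂ] Distr Ω := (dGammaSubmodule Ω Γ).subtype

theorem waveFrontSet_subset (u : DGamma Ω Γ) : waveFrontSet (toDistr Ω Γ u) ⊆ Γ :=
  Subtype.property (p := fun v => v ∈ dGammaSubmodule Ω Γ) u

end DGamma

/-- The triples `(N, V, χ)` formed by an integer `N`, a closed cone `V` of `ℝⁿ` and a test
function `χ` on `Ω` such that `supp χ × V` does not meet `Γ`. -/
structure ConeTest (Ω : Opens (Rn n)) (Γ : Set (Rn n × Rn n)) where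
  N : ℕ
  V : Set (Rn n)
  χ : 𝓓(Ω, ℂ)
  isClosed : IsClosed V
  isCone : IsCone V
  disjoint : (tsupport χ ×ˢ V) ∩ Γ = ∅

section Finiteness

variable {Ω : Opens (Rn n)} {Γ : Set (Rn n × Rn n)}

/-- A distribution that is microlocally smooth at all `(x, ξ)` with `ξ ≠ 0` in a closed cone `V`
has localizations near `x` whose Fourier transforms decrease rapidly on `V`. -/
theorem exists_local_bound (u : Distr Ω) (x : Rn n) {V : Set (Rn n)} (hV : IsClosed V)
    (hVc : IsCone V) (h : ∀ ξ ∈ V, ξ ≠ 0 → MicroSmoothAt u x ξ) :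
    ∃ U : Set (Rn n), IsOpen U ∧ x ∈ U ∧
      ∀ φ : 𝓓(Ω, ℂ), tsupport φ ⊆ U → ∀ N : ℕ, ∃ C : ℝ, ∀ k ∈ V,
        (1 + ‖k‖) ^ N * ‖fourierLoc φ k u‖ ≤ C := by
  have hK : IsCompact (V ∩ Metric.sphere (0 : Rn n) 1) :=
    (isCompact_sphere _ _).inter_left hV
  have h' : ∀ ξ : ↥(V ∩ Metric.sphere (0 : Rn n) 1), MicroSmoothAt u x ξ := fun ξ =>
    h ξ ξ.2.1 (fun h0 => by
      have h1 := ξ.2.2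
      rw [h0] at h1
      simp at h1)
  choose U hU hxU W hW hWc hξW hb using h'
  obtain ⟨t, ht⟩ := hK.elim_finite_subcover W hW
    (fun ξ hξ => Set.mem_iUnion.2 ⟨⟨ξ, hξ⟩, hξW ⟨ξ, hξ⟩⟩)
  refine ⟨⋂ i ∈ t, U i, isOpen_biInter_finset (fun i _ => hU i),
    Set.mem_iInter₂.2 (fun i _ => hxU i), fun φ hφ N => ?_⟩
  choose C hC using fun i (hi : i ∈ t) => hb i φ (hφ.trans (Set.biInter_subset_of_mem hi)) N
  refine ⟨‖fourierLoc φ 0 u‖ + ∑ i ∈ t.attach, |C i.1 i.2|, fun k hk => ?_⟩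
  have hs : 0 ≤ ∑ i ∈ t.attach, |C i.1 i.2| := Finset.sum_nonneg (fun _ _ => abs_nonneg _)
  by_cases hk0 : k = 0
  · subst hk0
    simpa using hs
  · have hn : 0 < ‖k‖ := norm_pos_iff.2 hk0
    have hmem : ‖k‖⁻¹ • k ∈ V ∩ Metric.sphere (0 : Rn n) 1 := by
      refine ⟨hVc hk (inv_pos.2 hn), ?_⟩
      simp [norm_smul, hn.ne']
    obtain ⟨i, hi, hki⟩ := Set.mem_iUnion₂.1 (ht hmem)
    have hki' : k ∈ W i := by
      have := hWc i hki hn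
      rwa [smul_smul, mul_inv_cancel₀ hn.ne', one_smul] at this
    calc (1 + ‖k‖) ^ N * ‖fourierLoc φ k u‖ ≤ C i hi := hC i hi k hki'
      _ ≤ |C i hi| := le_abs_self _
      _ ≤ ∑ i ∈ t.attach, |C i.1 i.2| :=
          Finset.single_le_sum (f := fun i : t => |C i.1 i.2|) (fun _ _ => abs_nonneg _)
            (Finset.mem_attach t ⟨i, hi⟩)
      _ ≤ _ := le_add_of_nonneg_left (norm_nonneg _)

/-- The suprema that define the seminorms of `𝓓'_Γ(Ω)` are finite. -/
theorem ConeTest.exists_bound (c : ConeTest Ω Γ) (u : DGamma Ω Γ) :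
    ∃ C : ℝ, ∀ k ∈ c.V,
      (1 + ‖k‖) ^ c.N * ‖fourierLoc c.χ k (DGamma.toDistr Ω Γ u)‖ ≤ C := by
  set v := DGamma.toDistr Ω Γ u
  have h : ∀ x : ↥(tsupport c.χ), ∀ ξ ∈ c.V, ξ ≠ 0 → MicroSmoothAt v x ξ := by
    intro x ξ hξ h0
    by_contra hns
    have hmem : ((x : Rn n), ξ) ∈ (tsupport c.χ ×ˢ c.V) ∩ Γ :=
      ⟨⟨x.2, hξ⟩, u.waveFrontSet_subset ⟨⟨c.χ.tsupport_subset x.2, h0⟩, hns⟩⟩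
    rw [c.disjoint] at hmem
    exact hmem
  choose U hU hxU hb using fun x : ↥(tsupport c.χ) =>
    exists_local_bound v (x : Rn n) c.isClosed c.isCone (h x)
  obtain ⟨t, ht⟩ := (show IsCompact (tsupport c.χ) from c.χ.hasCompactSupport).elim_finite_subcover
    U hU (fun x hx => Set.mem_iUnion.2 ⟨⟨x, hx⟩, hxU ⟨x, hx⟩⟩)
  obtain ⟨ρ, hρ⟩ := SmoothPartitionOfUnity.exists_isSubordinate (modelWithCornersSelf ℝ (Rn n))
    (isClosed_tsupport c.χ) (fun i : t => U i) (fun i => hU i)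
    (fun x hx => by
      obtain ⟨i, hi, hxi⟩ := Set.mem_iUnion₂.1 (ht hx)
      exact Set.mem_iUnion.2 ⟨⟨i, hi⟩, hxi⟩)
  have hsm : ∀ i : t, ContDiff ℝ ∞ (fun x => ((ρ i x : ℝ) : ℂ)) := fun i =>
    Complex.ofRealCLM.contDiff.comp (ρ i).contMDiff.contDiff
  let φ : t → 𝓓(Ω, ℂ) := fun i => smoothMul _ (hsm i) c.χ
  have hφ : ∀ i : t, tsupport (φ i) ⊆ U i := by
    intro i
    refine Set.Subset.trans ?_ (hρ i)
    refine closure_mono (fun x hx => ?_)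
    intro h0
    apply hx
    change ((ρ i x : ℝ) : ℂ) * c.χ x = 0
    simp [h0]
  have hsum : c.χ = ∑ i, φ i := by
    ext x
    have e : (∑ i, φ i) x = ∑ i, φ i x := by
      simp
    rw [e]
    change c.χ x = ∑ i, ((ρ i x : ℝ) : ℂ) * c.χ x
    rw [← Finset.sum_mul]
    by_cases hx : x ∈ tsupport c.χ
    · have h1 := ρ.sum_eq_one hx
      rw [finsum_eq_sum_of_fintype] at h1
      rw [← Complex.ofReal_sum, h1]
      simp
    · rw [image_eq_zero_of_notMem_tsupport hx, mul_zero]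
  have hF : ∀ k, fourierLoc c.χ k v = ∑ i, fourierLoc (φ i) k v := by
    intro k
    unfold fourierLoc
    rw [← map_sum]
    congr 1
    ext x
    have e : (∑ i, smoothMul (planeWave k) (contDiff_planeWave k) (φ i)) x
        = ∑ i, planeWave k x * φ i x := by
      simp [smoothMul]
    rw [e, ← Finset.mul_sum]
    have e' : (∑ i, φ i) x = ∑ i, φ i x := by simp
    rw [← e', ← hsum]
    rfl
  choose C hC using fun i : t => hb i (φ i) (hφ i) c.N
  refine ⟨∑ i, C i, fun k hk => ?_⟩
  rw [hF]
  calc (1 + ‖k‖) ^ c.N * ‖∑ i, fourierLoc (φ i) k v‖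
      ≤ (1 + ‖k‖) ^ c.N * ∑ i, ‖fourierLoc (φ i) k v‖ := by
        gcongr
        exact norm_sum_le _ _
    _ ≤ ∑ i, C i := by
        rw [Finset.mul_sum]
        exact Finset.sum_le_sum (fun i _ => hC i k hk)

theorem ConeTest.bddAbove (c : ConeTest Ω Γ) (u : DGamma Ω Γ) :
    BddAbove (Set.range fun k : c.V =>
      (1 + ‖(k : Rn n)‖) ^ c.N * ‖fourierLoc c.χ k (DGamma.toDistr Ω Γ u)‖) := by
  obtain ⟨C, hC⟩ := c.exists_bound u
  exact ⟨C, by rintro _ ⟨k, rfl⟩; exact hC k k.2⟩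

end Finiteness

namespace DGamma

variable {Ω : Opens (Rn n)} {Γ : Set (Rn n × Rn n)}

/-- The seminorm `u ↦ |⟨u, φ⟩|` of the weak topology. -/
def weakSeminorm (φ : 𝓓(Ω, ℂ)) : Seminorm ℂ (DGamma Ω Γ) :=
  Seminorm.of (fun u => ‖toDistr Ω Γ u φ‖)
    (fun u v => by
      rw [map_add]
      exact norm_add_le _ _)
    (fun a u => by
      rw [map_smul]
      exact norm_smul a (toDistr Ω Γ u φ))

/-- The seminorm `‖u‖_{N,V,χ} = sup_{k ∈ V} (1 + |k|)^N |(u χ)^(k)|`. -/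
def coneSeminorm (c : ConeTest Ω Γ) : Seminorm ℂ (DGamma Ω Γ) :=
  Seminorm.of
    (fun u => ⨆ k : c.V, (1 + ‖(k : Rn n)‖) ^ c.N * ‖fourierLoc c.χ k (toDistr Ω Γ u)‖)
    (fun u v => by
      have hnn : ∀ (w : DGamma Ω Γ) (k : c.V),
          0 ≤ (1 + ‖(k : Rn n)‖) ^ c.N * ‖fourierLoc c.χ k (toDistr Ω Γ w)‖ :=
        fun w k => by positivity
      refine Real.iSup_le (fun k => ?_)
        (add_nonneg (Real.iSup_nonneg (hnn u)) (Real.iSup_nonneg (hnn v)))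
      refine le_trans ?_ (add_le_add (le_ciSup (c.bddAbove u) k) (le_ciSup (c.bddAbove v) k))
      rw [map_add, fourierLoc_add, ← mul_add]
      gcongr
      exact norm_add_le _ _)
    (fun a u => by
      rw [Real.mul_iSup_of_nonneg (norm_nonneg a)]
      congr 1
      ext k
      rw [map_smul, fourierLoc_smul, norm_mul]
      ring)

variable (Ω Γ) in
/-- The family of all seminorms of the Hörmander topology of `𝓓'_Γ(Ω)`. -/
def seminorms : SeminormFamily ℂ (DGamma Ω Γ) (𝓓(Ω, ℂ) ⊕ ConeTest Ω Γ) :=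
  Sum.elim weakSeminorm coneSeminorm

/-- The Hörmander topology of `𝓓'_Γ(Ω)`: the locally convex topology defined by the seminorms
`|⟨u, φ⟩|` and `‖u‖_{N,V,χ}`. -/
instance : TopologicalSpace (DGamma Ω Γ) := (seminorms Ω Γ).moduleFilterBasis.topology

theorem withSeminorms : WithSeminorms (seminorms Ω Γ) := ⟨rfl⟩

/-- A sequence `u j` in `𝓓'_Γ(Ω)` converges to `v` in the sense of Hörmander: it converges weakly,
and `sup_{k ∈ V} (1 + |k|)^N |(u j χ)^(k) - (v χ)^(k)|` tends to `0` for all `N`, all test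
functions `χ` and all closed cones `V` such that `supp χ × V` does not meet `Γ`. -/
def HormanderTendsto (u : ℕ → DGamma Ω Γ) (v : DGamma Ω Γ) : Prop :=
  (∀ φ : 𝓓(Ω, ℂ), Tendsto (fun j => toDistr Ω Γ (u j) φ) atTop (𝓝 (toDistr Ω Γ v φ))) ∧
  ∀ (χ : 𝓓(Ω, ℂ)) (N : ℕ) (V : Set (Rn n)), IsClosed V → IsCone V →
    (tsupport χ ×ˢ V) ∩ Γ = ∅ →
    Tendsto (fun j => ⨆ k ∈ V, ENNReal.ofReal ((1 + ‖k‖) ^ N *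
      ‖fourierLoc χ k (toDistr Ω Γ (u j)) - fourierLoc χ k (toDistr Ω Γ v)‖)) atTop (𝓝 0)

end DGamma

variable {n₁ n₂ : ℕ} {Ω₁ : Opens (Rn n₁)} {Ω₂ : Opens (Rn n₂)}
  {Γ₁ : Set (Rn n₁ × Rn n₁)} {Γ₂ : Set (Rn n₂ × Rn n₂)}

/-- A map is sequentially continuous if it preserves convergence in the sense of Hörmander. -/
def HormanderSeqContinuous (f : DGamma Ω₁ Γ₁ → DGamma Ω₂ Γ₂) : Prop :=
  ∀ (u : ℕ → DGamma Ω₁ Γ₁) (v : DGamma Ω₁ Γ₁), DGamma.HormanderTendsto u v →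
    DGamma.HormanderTendsto (fun j => f (u j)) (f v)

/-- A map is bounded if it maps the bounded sets of the von Neumann bornology of its source to
bounded sets of the von Neumann bornology of its target. -/
def VonNBoundedMap (f : DGamma Ω₁ Γ₁ → DGamma Ω₂ Γ₂) : Prop :=
  ∀ B : Set (DGamma Ω₁ Γ₁), Bornology.IsVonNBounded ℂ B → Bornology.IsVonNBounded ℂ (f '' B)

end Microlocal

end

/-!
A sequentially continuous linear map is bounded by the usual rescaling argument: a bounded sequence
divided by `j + 1` is a null sequence. The converse needs that null sequences of `𝓓'_Γ(Ω)` are null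
in the sense of Mackey along subsequences: some subsequence stays bounded after multiplication of
its `l`-th term by `l + 1` (`DGamma.exists_isVonNBounded_smul`). A bounded map sends the rescaled
terms to a bounded set, so the images of the terms themselves tend to zero.

The topology of `𝓓'_Γ(Ω)` is not metrizable in general, so the subsequence cannot be extracted by a
diagonal argument over the seminorms themselves. Two facts reduce the matter to countably many
conditions.
* The weak seminorms are cone seminorms for the cone `{0}`, and countably many pairs `(K, V)` of a
  compact set and a closed cone with `(K × V) ∩ Γ = ∅` suffice to majorize all pairs
  `(supp χ, V)` (`exists_countable_conePair`).
* For a fixed pair `(K, V)` and a fixed `N`, a null sequence `u j` tends to zero for `‖·‖_{N,V,χ}`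
  uniformly when `χ` runs over the unit ball of some seminorm of `𝓓_K`
  (`DGamma.exists_eventually_coneSeminorm_le`). Indeed `𝓓_K` is a Fréchet space, so the linear
  forms `χ ↦ (1 + |k|)^N (u j χ)^(k)`, which are pointwise bounded for `j ∈ ℕ` and `k ∈ V`, are
  equicontinuous by the Banach–Steinhaus theorem; and by the Arzelà–Ascoli theorem a stronger
  seminorm has a totally bounded unit ball, on which pointwise convergence of an equicontinuous
  family is uniform (`ContDiffMapSupportedIn.exists_eventually_norm_le`).
-/

noncomputable section

/-! ### Spaces of smooth functions supported in a fixed compact set -/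

namespace ContDiffMapSupportedIn

open scoped BoundedContinuousFunction

variable {E F : Type*} [NormedAddCommGroup E] [NormedSpace ℝ E]
  [NormedAddCommGroup F] [NormedSpace ℝ F] {K : Compacts E}

/-- A uniform limit of all derivatives of smooth functions is the family of derivatives of a
smooth function: the limits form a Taylor series of the limit function. -/
theorem isClosed_range_pi_structureMapCLM :
    IsClosed (Set.range (ContinuousLinearMap.pi (structureMapCLM ℝ ⊤) :
      𝓓_{K}(E, F) →L[ℝ] Π i, E →ᵇ (E [×i]→L[ℝ] F))) := by
  refine isClosed_of_closure_subset fun g hg => ?_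
  have : ∀ i : ℕ, FirstCountableTopology (E →ᵇ (E [×i]→L[ℝ] F)) := fun _ =>
    UniformSpace.firstCountableTopology _
  obtain ⟨s, hs, hlim⟩ := mem_closure_iff_seq_limit.1 hg
  choose f hf using hs
  have hunif : ∀ i : ℕ, TendstoUniformly (fun j => iteratedFDeriv ℝ i (f j)) (g i) atTop := by
    intro i
    have h := BoundedContinuousFunction.tendsto_iff_tendstoUniformly.1 ((tendsto_pi_nhds.1 hlim) i)
    simp only [← hf, ContinuousLinearMap.pi_apply, structureMapCLM_top_apply] at h
    exact h
  have hpt : ∀ (i : ℕ) (x : E),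
      Tendsto (fun j => iteratedFDeriv ℝ i (f j) x) atTop (𝓝 (g i x)) :=
    fun i x => (hunif i).tendsto_at x
  have hderiv : ∀ (m : ℕ) (x : E), HasFDerivAt (g m) (g (m + 1) x).curryLeft x := by
    intro m x
    refine hasFDerivAt_of_tendstoUniformly (l := atTop)
      (f' := fun j y => (iteratedFDeriv ℝ (m + 1) (f j) y).curryLeft)
      (g' := fun y => (g (m + 1) y).curryLeft) (f := fun j => iteratedFDeriv ℝ m (f j))
      ?_ (fun j y => ?_) (hpt m) x
    · exact (continuousMultilinearCurryLeftEquiv ℝ (fun _ : Fin (m + 1) => E) F).isometry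
        |>.uniformContinuous.comp_tendstoUniformly (hunif (m + 1))
    · have h := (hasFTaylorSeriesUpTo_top_iff' le_rfl).1
        ((contDiff_iff_ftaylorSeries (n := ⊤)).1 (f j).contDiff)
      exact h.2 m y
  have hT : HasFTaylorSeriesUpTo ∞ (fun x => (g 0 x).curry0) (fun x i => g i x) :=
    (hasFTaylorSeriesUpTo_top_iff' le_rfl).2 ⟨fun _ => rfl, hderiv⟩
  refine ⟨⟨fun x => (g 0 x).curry0, hT.contDiff, fun x hx => ?_⟩, ?_⟩
  · have h0 : g 0 x = 0 := by
      refine tendsto_nhds_unique (hpt 0 x) ?_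
      simp [(f _).iteratedFDeriv_zero_on_compl hx]
    simp [h0]
  · funext i
    ext1 x
    rw [ContinuousLinearMap.pi_apply, structureMapCLM_top_apply]
    exact (hT.eq_iteratedFDeriv (mod_cast le_top) x).symm

/-- `𝓓_{K}` is completely metrizable, hence a Baire space and therefore barrelled. -/
instance [CompleteSpace F] : BaireSpace 𝓓_{K}(E, F) := by
  have h : IsClosedEmbedding (ContinuousLinearMap.pi (structureMapCLM ℝ ⊤) :
      𝓓_{K}(E, F) →L[ℝ] Π i, E →ᵇ (E [×i]→L[ℝ] F)) :=
    ⟨isUniformEmbedding_pi_structureMapCLM ℝ |>.isEmbedding, isClosed_range_pi_structureMapCLM⟩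
  have := h.IsCompletelyPseudoMetrizableSpace
  infer_instance


/-- Multilinear maps between finite-dimensional spaces form a finite-dimensional space. -/
theorem finiteDimensional_continuousMultilinearMap [FiniteDimensional ℝ E] [FiniteDimensional ℝ F]
    (i : ℕ) : FiniteDimensional ℝ (E [×i]→L[ℝ] F) :=
  FiniteDimensional.of_injective (ContinuousMultilinearMap.toMultilinearMapLinear (R' := ℝ) (A := ℝ)
    (M₁ := fun _ : Fin i => E) (M₂ := F))
    ContinuousMultilinearMap.toMultilinearMap_injective

theorem norm_iteratedFDeriv_sub_le (f : 𝓓_{K}(E, F)) (i : ℕ) (x y : E) :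
    ‖iteratedFDeriv ℝ i f x - iteratedFDeriv ℝ i f y‖ ≤ N[ℝ]_{K, i + 1} f * ‖x - y‖ := by
  refine convex_univ.norm_image_sub_le_of_norm_fderiv_le (𝕜 := ℝ) (fun z _ => ?_) (fun z _ => ?_)
    (Set.mem_univ y) (Set.mem_univ x)
  · exact (f.contDiff.differentiable_iteratedFDeriv (mod_cast ENat.natCast_lt_top i)) z
  · rw [norm_fderiv_iteratedFDeriv]
    exact norm_iteratedFDeriv_apply_le_seminorm_top ℝ

end ContDiffMapSupportedIn

/-! ### Total boundedness and uniform convergence of linear forms -/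

/-- The unit ball of the seminorm `q` is totally bounded for the seminorm `p`. -/
def Seminorm.UnitBallTotallyBounded {𝕜 V : Type*} [NormedField 𝕜] [AddCommGroup V] [Module 𝕜 V]
    (q p : Seminorm 𝕜 V) : Prop :=
  ∀ ε > 0, ∃ t : Set V, t.Finite ∧ ∀ x, q x ≤ 1 → ∃ c ∈ t, p (x - c) ≤ ε

namespace Seminorm

variable {𝕜 V : Type*} [NormedField 𝕜] [AddCommGroup V] [Module 𝕜 V]

theorem UnitBallTotallyBounded.sup {q₁ q₂ p₁ p₂ : Seminorm 𝕜 V}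
    (h₁ : q₁.UnitBallTotallyBounded p₁) (h₂ : q₂.UnitBallTotallyBounded p₂) :
    (q₁ ⊔ q₂).UnitBallTotallyBounded (p₁ ⊔ p₂) := by
  classical
  intro ε hε
  obtain ⟨t₁, ht₁, H₁⟩ := h₁ (ε / 2) (half_pos hε)
  obtain ⟨t₂, ht₂, H₂⟩ := h₂ (ε / 2) (half_pos hε)
  -- one point chosen in each nonempty intersection of a ball of the first net with a ball of the
  -- second one
  let R : V × V → V → Prop := fun c x => p₁ (x - c.1) ≤ ε / 2 ∧ p₂ (x - c.2) ≤ ε / 2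
  let r : V × V → V := fun c => if h : ∃ x, R c x then h.choose else 0
  refine ⟨r '' (t₁ ×ˢ t₂), (ht₁.prod ht₂).image r, fun x hx => ?_⟩
  obtain ⟨hx₁, hx₂⟩ := sup_le_iff.1 hx
  obtain ⟨c₁, hc₁, hp₁⟩ := H₁ x hx₁
  obtain ⟨c₂, hc₂, hp₂⟩ := H₂ x hx₂
  refine ⟨r (c₁, c₂), ⟨(c₁, c₂), ⟨hc₁, hc₂⟩, rfl⟩, ?_⟩
  have hex : ∃ y, R (c₁, c₂) y := ⟨x, hp₁, hp₂⟩
  have hr : R (c₁, c₂) (r (c₁, c₂)) := by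
    simp only [r, dif_pos hex]
    exact hex.choose_spec
  have key : ∀ (p : Seminorm 𝕜 V) (c y : V), p (x - c) ≤ ε / 2 → p (y - c) ≤ ε / 2 →
      p (x - y) ≤ ε := fun p c y hxc hyc =>
    calc p (x - y) = p ((x - c) - (y - c)) := by rw [sub_sub_sub_cancel_right]
      _ ≤ p (x - c) + p (y - c) := map_sub_le_add p _ _
      _ ≤ ε := by linarith
  exact sup_le (key p₁ c₁ _ hp₁ hr.1) (key p₂ c₂ _ hp₂ hr.2)

theorem UnitBallTotallyBounded.finset_sup {ι : Type*} {q p : ι → Seminorm 𝕜 V}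
    (h : ∀ i, (q i).UnitBallTotallyBounded (p i)) (s : Finset ι) :
    (s.sup q).UnitBallTotallyBounded (s.sup p) := by
  classical
  induction s using Finset.induction_on with
  | empty =>
    exact fun ε hε => ⟨{0}, Set.finite_singleton 0, fun x _ => ⟨0, rfl, by simpa using hε.le⟩⟩
  | insert i s _ ih =>
    rw [Finset.sup_insert, Finset.sup_insert]
    exact (h i).sup ih

end Seminorm

namespace ContDiffMapSupportedIn

open scoped BoundedContinuousFunction

variable {E F : Type*} [NormedAddCommGroup E] [NormedSpace ℝ E] [FiniteDimensional ℝ E]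
  [NormedAddCommGroup F] [NormedSpace ℝ F] [NormedSpace ℂ F] [FiniteDimensional ℝ F]
  [SMulCommClass ℝ ℂ F] {K : Compacts E}

/-- By the Arzelà–Ascoli theorem, a bound on the derivatives of orders `i` and `i + 1` gives
total boundedness for the uniform norm of the derivatives of order `i`. -/
theorem unitBallTotallyBounded_seminorm (i : ℕ) :
    (N[ℂ; F]_{K, i} ⊔ N[ℂ; F]_{K, i + 1}).UnitBallTotallyBounded N[ℂ; F]_{K, i} := by
  have := finiteDimensional_continuousMultilinearMap (E := E) (F := F) i
  have : ProperSpace (E [×i]→L[ℝ] F) := FiniteDimensional.proper ℝ _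
  have : CompactSpace K := isCompact_iff_compactSpace.1 K.isCompact
  let D : 𝓓_{K}(E, F) → K →ᵇ (E [×i]→L[ℝ] F) := fun f =>
    BoundedContinuousFunction.mkOfCompact
      ⟨fun x => iteratedFDeriv ℝ i f x,
        (f.contDiff.continuous_iteratedFDeriv (mod_cast le_top)).comp continuous_subtype_val⟩
  let B : Set 𝓓_{K}(E, F) := {f | (N[ℂ]_{K, i} ⊔ N[ℂ]_{K, i + 1}) f ≤ 1}
  have hB : ∀ f ∈ B, N[ℂ]_{K, i} f ≤ 1 ∧ N[ℂ]_{K, i + 1} f ≤ 1 := fun f hf => sup_le_iff.1 hf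
  have hcpt : IsCompact (closure (D '' B)) := by
    refine BoundedContinuousFunction.arzela_ascoli (Metric.closedBall 0 1)
      (isCompact_closedBall 0 1) _ ?_ ?_
    · rintro _ x ⟨f, hf, rfl⟩
      rw [mem_closedBall_zero_iff]
      exact (norm_iteratedFDeriv_apply_le_seminorm_top ℂ).trans (hB f hf).1
    · refine Metric.equicontinuous_of_continuity_modulus (fun d => d) tendsto_id _ ?_
      rintro x y ⟨_, f, hf, rfl⟩
      rw [dist_eq_norm]
      refine (norm_iteratedFDeriv_sub_le f i x y).trans ?_
      rw [Subtype.dist_eq, dist_eq_norm]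
      exact mul_le_of_le_one_left (norm_nonneg _) (hB f hf).2
  intro ε hε
  obtain ⟨t, htD, ht, hcov⟩ :=
    Metric.finite_approx_of_totallyBounded (hcpt.totallyBounded.subset subset_closure) ε hε
  choose! r hr using fun c (hc : c ∈ t) => htD hc
  refine ⟨r '' t, ht.image r, fun f hf => ?_⟩
  obtain ⟨c, hc, hfc⟩ := Set.mem_iUnion₂.1 (hcov ⟨f, hf, rfl⟩)
  refine ⟨r c, ⟨c, hc, rfl⟩, ?_⟩
  rw [← (hr c hc).2] at hfc
  generalize r c = g at hfc ⊢
  rw [ContDiffMapSupportedIn.seminorm_top_le_iff ℂ hε.le]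
  intro x hx
  have h := (BoundedContinuousFunction.dist_coe_le_dist (⟨x, hx⟩ : K)).trans hfc.le
  rw [dist_eq_norm] at h
  have e : iteratedFDeriv ℝ i (f - g) x = iteratedFDeriv ℝ i f x - iteratedFDeriv ℝ i g x :=
    iteratedFDeriv_sub_apply (f.contDiff.of_le (mod_cast le_top)).contDiffAt
      (g.contDiff.of_le (mod_cast le_top)).contDiffAt
  rw [e]
  exact h

/-- **Uniform convergence to zero of pointwise null families of linear forms.** Let `T j i` be
continuous linear forms on `𝓓_{K}` that tend to zero pointwise as `j → ∞`, uniformly in `i`. They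
then tend to zero uniformly in `i` and on the unit ball of a continuous seminorm: by the
Banach–Steinhaus theorem they are equicontinuous for some seminorm `p`, and the unit ball of a
stronger seminorm `q` is totally bounded for `p`. -/
theorem exists_eventually_norm_le {ι : Type*} (T : ℕ → ι → 𝓓_{K}(E, F) →L[ℂ] ℂ)
    (hbdd : ∀ j f, BddAbove (Set.range fun i => ‖T j i f‖))
    (hlim : ∀ f, ∀ ε > 0, ∀ᶠ j in atTop, ∀ i, ‖T j i f‖ ≤ ε) :
    ∃ q : Seminorm ℂ 𝓓_{K}(E, F), ∀ ε > 0, ∀ᶠ j in atTop, ∀ i f, ‖T j i f‖ ≤ ε * q f := by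
  have : CompleteSpace F := FiniteDimensional.complete ℝ F
  let P : ℕ × ι → Seminorm ℂ 𝓓_{K}(E, F) := fun a =>
    (normSeminorm ℂ ℂ).comp (T a.1 a.2).toLinearMap
  have hP : ∀ a f, P a f = ‖T a.1 a.2 f‖ := fun a f => rfl
  have hPb : BddAbove (Set.range P) := by
    rw [Seminorm.bddAbove_range_iff]
    intro f
    obtain ⟨j₀, hj₀⟩ := eventually_atTop.1 (hlim f 1 one_pos)
    choose C hC using fun j => hbdd j f
    refine ⟨1 + ∑ j ∈ Finset.range j₀, |C j|, ?_⟩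
    rintro _ ⟨⟨j, i⟩, rfl⟩
    have hs : 0 ≤ ∑ j ∈ Finset.range j₀, |C j| := Finset.sum_nonneg fun _ _ => abs_nonneg _
    rcases lt_or_ge j j₀ with hj | hj
    · have h1 := hC j ⟨i, rfl⟩
      have h2 := Finset.single_le_sum (f := fun j => |C j|) (fun _ _ => abs_nonneg _)
        (Finset.mem_range.2 hj)
      have h3 := le_abs_self (C j)
      simp only [hP] at h1 h2 ⊢
      linarith
    · have := hj₀ j hj i
      simp only [hP]
      linarith
  have hcont : Continuous (⨆ a, P a) :=
    Seminorm.continuous_iSup P (fun a => (T a.1 a.2).continuous.norm) hPb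
  rw [← Seminorm.coe_iSup_eq hPb] at hcont
  obtain ⟨s, C, -, hC⟩ := Seminorm.bound_of_continuous
    (ContDiffMapSupportedIn.withSeminorms ℂ E F ⊤ K) _ hcont
  set p := s.sup (ContDiffMapSupportedIn.seminorm ℂ E F ⊤ K)
  have hTp : ∀ j i f, ‖T j i f‖ ≤ C * p f := fun j i f =>
    calc P (j, i) f ≤ ⨆ a, P a f :=
          le_ciSup (f := fun a => P a f) (Seminorm.bddAbove_range_iff.1 hPb f) (j, i)
      _ = (⨆ a, P a) f := (Seminorm.iSup_apply hPb).symm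
      _ ≤ C * p f := hC f
  refine ⟨s.sup fun i => N[ℂ]_{K, i} ⊔ N[ℂ]_{K, i + 1}, fun ε hε => ?_⟩
  set q := s.sup fun i => N[ℂ; F]_{K, i} ⊔ N[ℂ; F]_{K, i + 1}
  have hqp : q.UnitBallTotallyBounded p := .finset_sup unitBallTotallyBounded_seminorm s
  have hC0 : (0 : ℝ) < C + 1 := by positivity
  obtain ⟨t, ht, hcov⟩ := hqp (ε / 2 / (C + 1)) (by positivity)
  filter_upwards [(ht.eventually_all).2 fun c _ => hlim c (ε / 2) (half_pos hε)] with j hj i f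
  have hball : ∀ g, q g ≤ 1 → ‖T j i g‖ ≤ ε := by
    intro g hg
    obtain ⟨c, hc, hgc⟩ := hcov g hg
    calc ‖T j i g‖ = ‖T j i (g - c) + T j i c‖ := by rw [← map_add, sub_add_cancel]
      _ ≤ ‖T j i (g - c)‖ + ‖T j i c‖ := norm_add_le _ _
      _ ≤ (C + 1) * (ε / 2 / (C + 1)) + ε / 2 := by
        refine add_le_add ((hTp j i _).trans ?_) (hj c hc i)
        exact mul_le_mul (by linarith) hgc (apply_nonneg _ _) hC0.le
      _ = ε := by rw [mul_div_cancel₀ _ hC0.ne', add_halves]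
  -- homogeneity, with a radius larger than `q f` because `q f` may vanish
  rw [mul_comm, ← div_le_iff₀ hε]
  refine le_of_forall_gt_imp_ge_of_dense fun r hr => ?_
  have hr0 : 0 < r := (apply_nonneg q f).trans_lt hr
  have hn : ‖((r⁻¹ : ℝ) : ℂ)‖ = r⁻¹ := by
    rw [Complex.norm_real, Real.norm_of_nonneg (inv_nonneg.2 hr0.le)]
  have h := hball (((r⁻¹ : ℝ) : ℂ) • f) (by
    rw [map_smul_eq_mul, hn, inv_mul_le_iff₀ hr0, mul_one]
    exact hr.le)
  rw [map_smul, norm_smul, hn, inv_mul_le_iff₀ hr0] at h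
  rwa [div_le_iff₀ hε]

end ContDiffMapSupportedIn

/-! ### Countable families of compact sets and closed cones -/

/-- In a locally compact, second countable Hausdorff space there are countably many compact sets
that interpolate between any compact set and any open set containing it. -/
theorem exists_countable_compacts_between (X : Type*) [TopologicalSpace X]
    [LocallyCompactSpace X] [SecondCountableTopology X] [T2Space X] :
    ∃ 𝒦 : Set (Compacts X), 𝒦.Countable ∧ ∀ A U : Set X, IsCompact A → IsOpen U → A ⊆ U →
      ∃ K ∈ 𝒦, A ⊆ K ∧ (K : Set X) ⊆ U := by
  have hb := isBasis_countableBasis X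
  -- closures of finite unions of basic open sets
  let S : Set (Set X) :=
    (fun s : Set (Set X) => closure (⋃₀ s)) '' {s | s.Finite ∧ s ⊆ countableBasis X}
  have hS : S.Countable := (Set.countable_ofPred_finite_subset (countable_countableBasis X)).image _
  refine ⟨(fun K : Compacts X => (K : Set X)) ⁻¹' S,
    hS.preimage_of_injOn (SetLike.coe_injective.injOn), fun A U hA hU hAU => ?_⟩
  obtain ⟨L, hL, hAL, hLU⟩ := exists_compact_between hA hU hAU
  choose! b hbB hxb hbL using fun x (hx : x ∈ A) =>
    hb.exists_closure_subset (isOpen_interior.mem_nhds (hAL hx))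
  obtain ⟨t, htA, ht⟩ := hA.elim_nhds_subcover b
    fun x hx => (hb.isOpen (hbB x hx)).mem_nhds (hxb x hx)
  have hcl : closure (⋃₀ (b '' t)) ⊆ L := by
    rw [Set.sUnion_image, t.finite_toSet.closure_biUnion]
    exact Set.iUnion₂_subset fun x hx => (hbL x (htA x hx)).trans interior_subset
  refine ⟨⟨closure (⋃₀ (b '' t)), hL.of_isClosed_subset isClosed_closure hcl⟩,
    ⟨b '' t, ⟨t.finite_toSet.image b, ?_⟩, rfl⟩, ?_, hcl.trans hLU⟩
  · rintro _ ⟨x, hx, rfl⟩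
    exact hbB x (htA x hx)
  · refine ht.trans (Set.Subset.trans ?_ subset_closure)
    rw [Set.sUnion_image]
    exact subset_rfl

namespace Microlocal

variable {n : ℕ}

/-- The cone over the part of `L` in the unit sphere: the origin and all `k` with `k / ‖k‖ ∈ L`. The
origin is always included, which makes the cone closed when `L` is. -/
def coneOver (L : Set (Rn n)) : Set (Rn n) := {k | k ≠ 0 → ‖k‖⁻¹ • k ∈ L}

theorem isClosed_coneOver {L : Set (Rn n)} (hL : IsClosed L) : IsClosed (coneOver L) := by
  have hc : ContinuousOn (fun k : Rn n => ‖k‖⁻¹ • k) {k | k ≠ 0} :=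
    (continuous_norm.continuousOn.inv₀ fun k hk => norm_ne_zero_iff.2 hk).smul continuousOn_id
  have h := hc.isOpen_inter_preimage isOpen_ne hL.isOpen_compl
  rw [← isOpen_compl_iff]
  convert h using 1
  ext k
  simp [coneOver]

theorem isCone_coneOver (L : Set (Rn n)) : IsCone (coneOver L) := by
  intro k hk t ht h0
  have hk0 : k ≠ 0 := fun h => h0 (by simp [h])
  have e : ‖t • k‖⁻¹ • t • k = ‖k‖⁻¹ • k := by
    rw [norm_smul, Real.norm_of_nonneg ht.le, smul_smul]
    congr 1
    field_simp
  rw [e]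
  exact hk hk0

/-- A pair of a compact subset of `Ω` and a closed cone whose product does not meet `Γ`. -/
structure ConePair (Ω : Opens (Rn n)) (Γ : Set (Rn n × Rn n)) where
  K : Compacts (Rn n)
  V : Set (Rn n)
  subset : (K : Set (Rn n)) ⊆ Ω
  isClosed : IsClosed V
  isCone : IsCone V
  disjoint : ((K : Set (Rn n)) ×ˢ V) ∩ Γ = ∅

/-- The test `(N, V, χ)` given by a pair `(K, V)` and a test function `χ` supported in `K`. -/
def ConePair.toConeTest {Ω : Opens (Rn n)} {Γ : Set (Rn n × Rn n)} (P : ConePair Ω Γ)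
    (N : ℕ) (χ : 𝓓_{P.K}(Rn n, ℂ)) : ConeTest Ω Γ where
  N := N
  V := P.V
  χ := TestFunction.ofSupportedIn P.subset χ
  isClosed := P.isClosed
  isCone := P.isCone
  disjoint := Set.subset_empty_iff.1 <| P.disjoint ▸
    Set.inter_subset_inter_left Γ (Set.prod_mono_left χ.tsupport_subset)

/-- Countably many pairs of a compact set and a closed cone control all pairs: by the tube lemma,
the compact set and the trace of the cone on the unit sphere can be enlarged to members of a
countable family. -/
theorem exists_countable_conePair {Ω : Opens (Rn n)} {Γ : Set (Rn n × Rn n)}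
    (hΓ : IsClosedCone Ω Γ) :
    ∃ 𝒢 : Set (ConePair Ω Γ), 𝒢.Countable ∧ ∀ (A V : Set (Rn n)), IsCompact A → A ⊆ Ω →
      IsClosed V → IsCone V → (A ×ˢ V) ∩ Γ = ∅ → ∃ P ∈ 𝒢, A ⊆ P.K ∧ V ⊆ P.V := by
  obtain ⟨𝒦, h𝒦, hcov⟩ := exists_countable_compacts_between (Rn n)
  let 𝒢 : Set (ConePair Ω Γ) := {P | P.K ∈ 𝒦 ∧ ∃ L ∈ 𝒦, P.V = coneOver (L : Set (Rn n))}
  refine ⟨𝒢, ?_, ?_⟩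
  · have hc : (𝒦 ×ˢ ((fun L : Compacts (Rn n) => coneOver (L : Set (Rn n))) '' 𝒦)).Countable :=
      h𝒦.prod (h𝒦.image _)
    refine Set.MapsTo.countable_of_injOn (f := fun P : ConePair Ω Γ => (P.K, P.V)) ?_ ?_ hc
    · rintro P ⟨hK, L, hL, hV⟩
      exact ⟨hK, L, hL, hV.symm⟩
    · rintro ⟨K, V, _, _, _, _⟩ _ ⟨K', V', _, _, _, _⟩ _ h
      simpa using h
  · intro A V hA hAΩ hV hVc hdisj
    obtain ⟨F, hF, hΓF⟩ := hΓ.isClosed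
    have hT : IsCompact (V ∩ Metric.sphere (0 : Rn n) 1) := (isCompact_sphere _ _).inter_left hV
    have hsub : A ×ˢ (V ∩ Metric.sphere (0 : Rn n) 1) ⊆ Fᶜ := by
      rintro ⟨x, k⟩ ⟨hx, hkV, hk⟩ hxF
      have hk0 : k ≠ 0 := ne_zero_of_mem_unit_sphere ⟨k, hk⟩
      have hmem : (x, k) ∈ (A ×ˢ V) ∩ Γ := ⟨⟨hx, hkV⟩, hΓF ▸ ⟨hxF, hAΩ hx, hk0⟩⟩
      rw [hdisj] at hmem
      exact hmem
    obtain ⟨u, v, hu, hv, hAu, hTv, huv⟩ := generalized_tube_lemma hA hT hF.isOpen_compl hsub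
    obtain ⟨K, hK, hAK, hKu⟩ := hcov A (u ∩ Ω) hA (hu.inter Ω.isOpen) (Set.subset_inter hAu hAΩ)
    obtain ⟨L, hL, hTL, hLv⟩ := hcov _ v hT hv hTv
    refine ⟨⟨K, coneOver L, hKu.trans Set.inter_subset_right,
      isClosed_coneOver L.isCompact.isClosed, isCone_coneOver _, ?_⟩, ⟨hK, L, hL, rfl⟩, hAK, ?_⟩
    · refine Set.eq_empty_of_forall_notMem ?_
      rintro ⟨x, k⟩ ⟨⟨hx, hk⟩, hxk⟩
      have hk0 : k ≠ 0 := (hΓ.subset hxk).2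
      have hmem := hΓ.smul_mem hxk (inv_pos.2 (norm_pos_iff.2 hk0))
      rw [hΓF] at hmem
      exact huv (Set.mk_mem_prod (hKu hx).1 (hLv (hk hk0))) hmem.1
    · intro k hk hk0
      refine hTL ⟨hVc hk (inv_pos.2 (norm_pos_iff.2 hk0)), ?_⟩
      simp [norm_smul, hk0]

end Microlocal

/-! ### Seminorms and convergence in the sense of Hörmander -/

namespace Microlocal

variable {n : ℕ} {Ω : Opens (Rn n)} {Γ : Set (Rn n × Rn n)}

namespace DGamma

theorem coneSeminorm_le_iff (c : ConeTest Ω Γ) (u : DGamma Ω Γ) {C : ℝ} (hC : 0 ≤ C) :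
    coneSeminorm c u ≤ C ↔
      ∀ k ∈ c.V, (1 + ‖k‖) ^ c.N * ‖fourierLoc c.χ k (toDistr Ω Γ u)‖ ≤ C := by
  change (⨆ k : c.V, (1 + ‖(k : Rn n)‖) ^ c.N * ‖fourierLoc c.χ k (toDistr Ω Γ u)‖) ≤ C ↔ _
  refine ⟨fun h k hk => (le_ciSup (c.bddAbove u) ⟨k, hk⟩).trans h,
    fun h => Real.iSup_le (fun k => h k k.2) hC⟩

/-- The test with `N = 0` and `V = {0}`: its seminorm is the seminorm `u ↦ |⟨u, φ⟩|`. -/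
def zeroConeTest (hΓ : IsClosedCone Ω Γ) (φ : 𝓓(Ω, ℂ)) : ConeTest Ω Γ where
  N := 0
  V := {0}
  χ := φ
  isClosed := isClosed_singleton
  isCone := by rintro ξ rfl t -; simp
  disjoint := by
    refine Set.eq_empty_of_forall_notMem ?_
    rintro ⟨x, k⟩ ⟨⟨-, hk⟩, h⟩
    exact (hΓ.subset h).2 hk

theorem weakSeminorm_le_coneSeminorm (hΓ : IsClosedCone Ω Γ) (φ : 𝓓(Ω, ℂ)) (u : DGamma Ω Γ) :
    weakSeminorm φ u ≤ coneSeminorm (zeroConeTest hΓ φ) u := by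
  have h := (coneSeminorm_le_iff (zeroConeTest hΓ φ) u (apply_nonneg _ _)).1 le_rfl 0 rfl
  have e : smoothMul (planeWave 0) (contDiff_planeWave 0) φ = φ := by
    ext x
    change planeWave 0 x * φ x = φ x
    simp [planeWave]
  change ‖toDistr Ω Γ u φ‖ ≤ _
  simpa [zeroConeTest, fourierLoc, e] using h

/-- Convergence in the sense of Hörmander is convergence for all seminorms `‖·‖_{N,V,χ}`; the weak
convergence is a special case. -/
theorem hormanderTendsto_iff (hΓ : IsClosedCone Ω Γ) (u : ℕ → DGamma Ω Γ) (v : DGamma Ω Γ) :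
    HormanderTendsto u v ↔
      ∀ c : ConeTest Ω Γ, Tendsto (fun j => coneSeminorm c (u j - v)) atTop (𝓝 0) := by
  have key : ∀ (c : ConeTest Ω Γ) (j : ℕ), (⨆ k ∈ c.V, ENNReal.ofReal ((1 + ‖k‖) ^ c.N *
      ‖fourierLoc c.χ k (toDistr Ω Γ (u j)) - fourierLoc c.χ k (toDistr Ω Γ v)‖)) =
      ENNReal.ofReal (coneSeminorm c (u j - v)) := by
    intro c j
    have hF : ∀ k, fourierLoc c.χ k (toDistr Ω Γ (u j)) - fourierLoc c.χ k (toDistr Ω Γ v) =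
        fourierLoc c.χ k (toDistr Ω Γ (u j - v)) := fun k => by rw [map_sub]; rfl
    refine eq_of_forall_ge_iff fun C => ?_
    induction C with
    | top => simp
    | coe C =>
      simp only [iSup_le_iff, hF]
      rw [← ENNReal.ofReal_coe_nnreal, ENNReal.ofReal_le_ofReal_iff C.coe_nonneg,
        coneSeminorm_le_iff c _ C.coe_nonneg]
      exact forall₂_congr fun k _ => ENNReal.ofReal_le_ofReal_iff C.coe_nonneg
  have key' : ∀ c : ConeTest Ω Γ,
      Tendsto (fun j => ENNReal.ofReal (coneSeminorm c (u j - v))) atTop (𝓝 0) ↔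
        Tendsto (fun j => coneSeminorm c (u j - v)) atTop (𝓝 0) := by
    refine fun c => ⟨fun h => ?_, fun h => by simpa using ENNReal.tendsto_ofReal h⟩
    simpa [Function.comp_def, ENNReal.toReal_ofReal (apply_nonneg (coneSeminorm c) _)] using
      (ENNReal.tendsto_toReal ENNReal.zero_ne_top).comp h
  constructor
  · rintro ⟨-, h⟩ c
    rw [← key']
    simpa only [key] using h c.χ c.N c.V c.isClosed c.isCone c.disjoint
  · intro h
    refine ⟨fun φ => ?_, fun χ N V hV hVc hd => ?_⟩
    · rw [tendsto_iff_norm_sub_tendsto_zero]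
      refine squeeze_zero (fun _ => norm_nonneg _) (fun j => ?_) (h (zeroConeTest hΓ φ))
      refine le_trans (le_of_eq ?_) (weakSeminorm_le_coneSeminorm hΓ φ (u j - v))
      change _ = ‖toDistr Ω Γ (u j - v) φ‖
      rw [map_sub]
      rfl
    · simpa only [← key ⟨N, V, χ, hV, hVc, hd⟩] using (key' ⟨N, V, χ, hV, hVc, hd⟩).2 (h _)

theorem isVonNBounded_iff (hΓ : IsClosedCone Ω Γ) (B : Set (DGamma Ω Γ)) :
    Bornology.IsVonNBounded ℂ B ↔ ∀ c : ConeTest Ω Γ, BddAbove (coneSeminorm c '' B) := by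
  rw [(withSeminorms (Ω := Ω) (Γ := Γ)).isVonNBounded_iff_seminorm_bddAbove]
  refine ⟨fun h c => h (Sum.inr c), ?_⟩
  rintro h (φ | c)
  · obtain ⟨C, hC⟩ := h (zeroConeTest hΓ φ)
    refine ⟨C, ?_⟩
    rintro _ ⟨u, hu, rfl⟩
    exact (weakSeminorm_le_coneSeminorm hΓ φ u).trans (hC ⟨u, hu, rfl⟩)
  · exact h c

/-! ### Null sequences are fast along a subsequence -/

/-- The linear form `χ ↦ (1 + |k|)^N (u χ)^(k)` on the test functions supported in `K`. -/
def weightedFourier {K : Compacts (Rn n)} (hK : (K : Set (Rn n)) ⊆ Ω) (N : ℕ) (u : Distr Ω)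
    (k : Rn n) : 𝓓_{K}(Rn n, ℂ) →L[ℂ] ℂ :=
  ((1 + ‖k‖ : ℝ) ^ N : ℂ) • ((u.comp (TestFunction.ofSupportedInCLM ℂ hK)).comp
    (ContDiffMapSupportedIn.bilinLeftCLM (ContinuousLinearMap.mul ℂ ℂ) (contDiff_planeWave k)))

theorem norm_weightedFourier {K : Compacts (Rn n)} (hK : (K : Set (Rn n)) ⊆ Ω) (N : ℕ)
    (u : Distr Ω) (k : Rn n) (χ : 𝓓_{K}(Rn n, ℂ)) :
    ‖weightedFourier hK N u k χ‖ =
      (1 + ‖k‖) ^ N * ‖fourierLoc (TestFunction.ofSupportedIn hK χ) k u‖ := by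
  have e : TestFunction.ofSupportedIn hK (ContDiffMapSupportedIn.bilinLeftCLM
      (ContinuousLinearMap.mul ℂ ℂ) (contDiff_planeWave k) χ) =
      smoothMul (planeWave k) (contDiff_planeWave k) (TestFunction.ofSupportedIn hK χ) := by
    ext x
    exact mul_comm (χ x) (planeWave k x)
  have h1 : ‖((1 + ‖k‖ : ℝ) ^ N : ℂ)‖ = (1 + ‖k‖) ^ N := by
    rw [norm_pow, Complex.norm_real, Real.norm_of_nonneg (by positivity)]
  change ‖((1 + ‖k‖ : ℝ) ^ N : ℂ) * u (TestFunction.ofSupportedIn hK _)‖ = _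
  rw [norm_mul, h1]
  exact congrArg (fun ψ => (1 + ‖k‖) ^ N * ‖u ψ‖) e

/-- A null sequence tends to zero for `‖·‖_{N,V,χ}` uniformly when `χ` runs over the unit ball of a
seminorm of the space of test functions supported in `K`. -/
theorem exists_eventually_coneSeminorm_le {u : ℕ → DGamma Ω Γ}
    (hu : ∀ c : ConeTest Ω Γ, Tendsto (fun j => coneSeminorm c (u j)) atTop (𝓝 0))
    (P : ConePair Ω Γ) (N : ℕ) :
    ∃ q : Seminorm ℂ 𝓓_{P.K}(Rn n, ℂ), ∀ ε > 0, ∀ᶠ j in atTop, ∀ χ,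
      coneSeminorm (P.toConeTest N χ) (u j) ≤ ε * q χ := by
  have hle : ∀ j (χ : 𝓓_{P.K}(Rn n, ℂ)) {C : ℝ}, 0 ≤ C →
      (coneSeminorm (P.toConeTest N χ) (u j) ≤ C ↔
        ∀ k : P.V, ‖weightedFourier P.subset N (toDistr Ω Γ (u j)) k χ‖ ≤ C) := by
    intro j χ C hC
    rw [coneSeminorm_le_iff _ _ hC]
    simp only [norm_weightedFourier, Subtype.forall]
    rfl
  obtain ⟨q, hq⟩ := ContDiffMapSupportedIn.exists_eventually_norm_le
    (fun j (k : P.V) => weightedFourier P.subset N (toDistr Ω Γ (u j)) k)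
    (fun j χ => ⟨_, Set.forall_mem_range.2 ((hle j χ (apply_nonneg _ _)).1 le_rfl)⟩)
    (fun χ ε hε => by
      filter_upwards [(hu (P.toConeTest N χ)).eventually_le_const hε] with j hj
      exact (hle j χ hε.le).1 hj)
  refine ⟨q, fun ε hε => ?_⟩
  filter_upwards [hq ε hε] with j hj χ
  exact (hle j χ (mul_nonneg hε.le (apply_nonneg _ _))).2 fun k => hj k χ

/-- Along any frequent set of indices, a null sequence has a subsequence that tends to zero so fast
that it stays bounded after multiplication of its `l`-th term by `l + 1`. -/
theorem exists_isVonNBounded_smul (hΓ : IsClosedCone Ω Γ) {u : ℕ → DGamma Ω Γ}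
    (hu : ∀ c : ConeTest Ω Γ, Tendsto (fun j => coneSeminorm c (u j)) atTop (𝓝 0))
    {Q : ℕ → Prop} (hQ : ∃ᶠ j in atTop, Q j) :
    ∃ φ : ℕ → ℕ, (∀ l, Q (φ l)) ∧
      Bornology.IsVonNBounded ℂ (Set.range fun l : ℕ => ((l + 1 : ℝ) : ℂ) • u (φ l)) := by
  obtain ⟨𝒢, h𝒢, hcov⟩ := exists_countable_conePair hΓ
  have : Countable 𝒢 := h𝒢
  obtain ⟨code, hcode⟩ := exists_injective_nat (𝒢 × ℕ)
  choose q hq using fun a : 𝒢 × ℕ => exists_eventually_coneSeminorm_le hu a.1.1 a.2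
  -- the first `l + 1` conditions of the countable family hold from some index on
  have hl : ∀ l : ℕ, ∀ᶠ j in atTop, ∀ a : 𝒢 × ℕ, code a ≤ l → ∀ χ,
      coneSeminorm (a.1.1.toConeTest a.2 χ) (u j) ≤ (l + 1 : ℝ)⁻¹ * q a χ := by
    intro l
    have hfin : {a : 𝒢 × ℕ | code a ≤ l}.Finite :=
      (Set.finite_Iic l).preimage hcode.injOn
    exact (hfin.eventually_all).2 fun a _ => hq a _ (by positivity)
  obtain ⟨φ, -, hφ⟩ := extraction_forall_of_frequently fun l => hQ.and_eventually (hl l)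
  refine ⟨φ, fun l => (hφ l).1, (isVonNBounded_iff hΓ _).2 fun c => ?_⟩
  obtain ⟨P, hP, hKP, hVP⟩ := hcov (tsupport c.χ) c.V c.χ.hasCompactSupport c.χ.tsupport_subset
    c.isClosed c.isCone c.disjoint
  let χ : 𝓓_{P.K}(Rn n, ℂ) :=
    .of_support_subset c.χ.contDiff ((subset_tsupport _).trans hKP)
  have hc : ∀ w, coneSeminorm c w ≤ coneSeminorm (P.toConeTest c.N χ) w := fun w =>
    (coneSeminorm_le_iff c w (apply_nonneg _ _)).2 fun k hk =>
      (coneSeminorm_le_iff (P.toConeTest c.N χ) w (apply_nonneg _ _)).1 le_rfl k (hVP hk)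
  let a : 𝒢 × ℕ := (⟨P, hP⟩, c.N)
  have htail : ∀ l ≥ code a, coneSeminorm c (((l + 1 : ℝ) : ℂ) • u (φ l)) ≤ q a χ := by
    intro l hla
    have hl0 : (0 : ℝ) < l + 1 := by positivity
    have h := (hc _).trans ((hφ l).2 a hla χ)
    rw [map_smul_eq_mul, Complex.norm_real, Real.norm_of_nonneg hl0.le]
    rwa [inv_mul_eq_div, le_div_iff₀' hl0] at h
  have hb : BddAbove (Set.range fun l : ℕ => coneSeminorm c (((l + 1 : ℝ) : ℂ) • u (φ l))) :=
    (isBoundedUnder_of_eventually_le (eventually_atTop.2 ⟨_, htail⟩)).bddAbove_range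
  rwa [← Set.range_comp]

end DGamma

/-! ### Bounded and sequentially continuous linear maps -/

open DGamma

variable {n₁ n₂ : ℕ} {Ω₁ : Opens (Rn n₁)} {Ω₂ : Opens (Rn n₂)}
  {Γ₁ : Set (Rn n₁ × Rn n₁)} {Γ₂ : Set (Rn n₂ × Rn n₂)}

/-- If `f u` is unbounded as `u` runs over the bounded set `B`, some `u j ∈ B` have `f (u j)` larger
than `j + 1` for a seminorm of the target; but `(j + 1)⁻¹ • u j` is a null sequence. -/
theorem HormanderSeqContinuous.vonNBoundedMap (hΓ₁ : IsClosedCone Ω₁ Γ₁)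
    (hΓ₂ : IsClosedCone Ω₂ Γ₂) {f : DGamma Ω₁ Γ₁ →ₗ[ℂ] DGamma Ω₂ Γ₂}
    (hf : HormanderSeqContinuous f) : VonNBoundedMap f := by
  intro B hB
  rw [isVonNBounded_iff hΓ₁] at hB
  rw [isVonNBounded_iff hΓ₂]
  intro c
  by_contra hc
  have hbig : ∀ j : ℕ, ∃ u ∈ B, ((j : ℝ) + 1) < coneSeminorm c (f u) := by
    intro j
    by_contra! h
    exact hc ⟨j + 1, by rintro _ ⟨_, ⟨u, hu, rfl⟩, rfl⟩; exact h u hu⟩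
  choose u huB hu using hbig
  have hnorm : ∀ j : ℕ, ‖(((j + 1 : ℝ)⁻¹ : ℝ) : ℂ)‖ = (j + 1 : ℝ)⁻¹ := fun j => by
    rw [Complex.norm_real, Real.norm_of_nonneg (by positivity)]
  have hinv : Tendsto (fun j : ℕ => (j + 1 : ℝ)⁻¹) atTop (𝓝 0) := by
    simpa using tendsto_one_div_add_atTop_nhds_zero_nat (𝕜 := ℝ)
  have h0 : HormanderTendsto (fun j => (((j + 1 : ℝ)⁻¹ : ℝ) : ℂ) • u j) 0 := by
    rw [hormanderTendsto_iff hΓ₁]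
    intro d
    obtain ⟨C, hC⟩ := hB d
    refine squeeze_zero (fun _ => apply_nonneg _ _) (fun j => ?_) (by simpa using hinv.mul_const C)
    rw [sub_zero, map_smul_eq_mul, hnorm]
    gcongr
    exact hC ⟨u j, huB j, rfl⟩
  have h1 := (hormanderTendsto_iff hΓ₂ _ _).1 (hf _ _ h0) c
  obtain ⟨j, hj⟩ := (h1.eventually_lt_const one_pos).exists
  rw [map_zero, sub_zero, map_smul, map_smul_eq_mul, hnorm,
    inv_mul_lt_iff₀ (by positivity), mul_one] at hj
  exact lt_asymm hj (hu j)

/-- If `f (u j - v)` stayed away from zero frequently, it would be unbounded on the bounded set of the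
rescaled terms of a fast subsequence of `u j - v`. -/
theorem VonNBoundedMap.hormanderSeqContinuous (hΓ₁ : IsClosedCone Ω₁ Γ₁)
    (hΓ₂ : IsClosedCone Ω₂ Γ₂) {f : DGamma Ω₁ Γ₁ →ₗ[ℂ] DGamma Ω₂ Γ₂}
    (hf : VonNBoundedMap f) : HormanderSeqContinuous f := by
  intro u v huv
  rw [hormanderTendsto_iff hΓ₁] at huv
  rw [hormanderTendsto_iff hΓ₂]
  intro c
  refine tendsto_order.2
    ⟨fun r hr => Eventually.of_forall fun j => hr.trans_le (apply_nonneg _ _), fun ε hε => ?_⟩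
  by_contra hfreq
  obtain ⟨φ, hφ, hbdd⟩ := exists_isVonNBounded_smul hΓ₁ huv (not_eventually.1 hfreq)
  obtain ⟨C, hC⟩ := (isVonNBounded_iff hΓ₂ _).1 (hf _ hbdd) c
  obtain ⟨l, hl⟩ := exists_nat_gt (C / ε)
  have h1 : coneSeminorm c (f (((l + 1 : ℝ) : ℂ) • (u (φ l) - v))) ≤ C :=
    hC ⟨_, ⟨_, ⟨l, rfl⟩, rfl⟩, rfl⟩
  rw [map_smul, map_smul_eq_mul, map_sub, Complex.norm_real,
    Real.norm_of_nonneg (by positivity)] at h1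
  have h2 : ε ≤ coneSeminorm c (f (u (φ l)) - f v) := not_lt.1 (hφ l)
  rw [div_lt_iff₀ hε] at hl
  have h3 : ((l : ℝ) + 1) * ε ≤ (l + 1) * coneSeminorm c (f (u (φ l)) - f v) := by gcongr
  linarith

end Microlocal

end

theorem proposition2p7 {n₁ n₂ : ℕ} (Ω₁ : TopologicalSpace.Opens (EuclideanSpace ℝ (Fin n₁)))
    (Ω₂ : TopologicalSpace.Opens (EuclideanSpace ℝ (Fin n₂)))
    (Γ₁ : Set (EuclideanSpace ℝ (Fin n₁) × EuclideanSpace ℝ (Fin n₁)))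
    (Γ₂ : Set (EuclideanSpace ℝ (Fin n₂) × EuclideanSpace ℝ (Fin n₂)))
    (hΓ₁ : Microlocal.IsClosedCone Ω₁ Γ₁) (hΓ₂ : Microlocal.IsClosedCone Ω₂ Γ₂)
    (f : Microlocal.DGamma Ω₁ Γ₁ →ₗ[ℂ]
      Microlocal.DGamma Ω₂ Γ₂) :
    Microlocal.HormanderSeqContinuous f ↔
      Microlocal.VonNBoundedMap f :=
  ⟨fun h => h.vonNBoundedMap hΓ₁ hΓ₂, fun h => h.hormanderSeqContinuous hΓ₁ hΓ₂⟩
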